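/- **Setting.** Let $\mathcal K\subseteq\mathbb R^d$ be closed and convex, $\eta>0$, $G_0\in\mathbb R^{d\times d}$ symmetric positive definite, and let $0=t_1\le t_2\le\dots\le t_K=T$ be fixed update points. Generic Epoch AdaGrad starts at some $x_1\in\mathcal K$. In round $s=1,\dots,T$ it plays $x_s$ and receives a convex loss $f_s:\mathcal K\to\mathbb R$ with gradient $g_s=\nabla f_s(x_s)$. It sets $G_s=G_{s-1}+g_sg_s^\top$, and for $t_k<s\le t_{k+1}$ it updates $$x_{s+1}=\operatorname*{arg\,min}_{z\in\mathcal K}\bigl\|z-\bigl(x_s-\eta\,G_{t_k}^{-1/2}g_s\bigr)\bigr\|^2_{G_{t_k}^{1/2}},\qquad \|v\|_H^2=v^\top Hv$$ (no projection if $\mathcal K=\mathbb R^d$). For a comparator $x_*\in\mathcal K$ let $R_T(x_*)=\sum_{s=1}^T f_s(x_s)-\sum_{s=1}^T f_s(x_*)$, and let $R_T=\sum_{s=1}^T f_s(x_s)-\inf_{x\in\mathcal K}\sum_{s=1}^T f_s(x)$. Let $D$ be such that $\|x_s-x_*\|_2\le D$ for $1\le s\le T$. For $1\le k\le K-1$ put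 $$A_k=G_{t_{k+1}}-G_{t_k},\qquad S_k=\int_0^\infty e^{-\tau G_{t_k}^{1/2}}A_k\,e^{-\tau G_{t_k}^{1/2}}\,d\tau,\qquad \epsilon_k=\operatorname{tr}\bigl(G_{t_k}^{-1/2}S_kG_{t_k}^{-1/2}A_k\bigr).$$ **(1) Regret bound.** The integrals $S_k$ converge absolutely, and for every $x_*\in\mathcal K$ $$R_T(x_*)\le\frac{D^2}{\eta}\operatorname{tr}G_T^{1/2}+\frac{\eta}{2}\Bigl(2\operatorname{tr}G_T^{1/2}-2\operatorname{tr}G_0^{1/2}+\sum_{k=1}^{K-1}\epsilon_k\Bigr).$$ If $x_*$ minimizes $\sum_{s=1}^T f_s$ over $\mathcal K$, the same bound holds for $R_T$. **(2) Well-conditioned case.** For every $\beta>0$ there is a constant $C>0$ depending only on $\beta$ such that the following holds. Let $T\ge2$, $\delta>0$, $\sigma_{\min}>0$ and $\sigma_{\max}\in\mathbb R$, and let the losses, and hence $g_s,x_s,G_s$ (and also $x_*$ and $D$), be random, with $G_0$, $\eta$ and the $t_k$ deterministic. Suppose that * for each $1\le k\le K-1$, with probability at least $1-\delta/2K$, $A_k\preceq\beta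 G_{t_k}$; * for each $k$ with $t_k>0$, with probability at least $1-\delta/2K$, all eigenvalues of $G_{t_k}$ lie in $[\sigma_{\min}t_k,\ \sigma_{\max}t_k]$. Then with probability at least $1-\delta$ all of the following hold simultaneously: $$\epsilon_k\le\beta^2\sqrt{\tfrac{\sigma_{\max}}{\sigma_{\min}}}\operatorname{tr}G_{t_k}^{1/2}\quad(1\le k\le K-1),\qquad \sum_{k=1}^{K-1}\epsilon_k\le C\sqrt{\tfrac{\sigma_{\max}}{\sigma_{\min}}}\,\log T\,\operatorname{tr}G_T^{1/2},$$ $$R_T(x_*)\le\frac{D^2}{\eta}\operatorname{tr}G_T^{1/2}+C\,\eta\sqrt{\tfrac{\sigma_{\max}}{\sigma_{\min}}}\,\log T\,\operatorname{tr}G_T^{1/2},$$ and, if $x_*$ minimizes $\sum_{s=1}^T f_s$ over $\mathcal K$, the last bound also holds for $R_T$. -/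

import Mathlib

open Set MeasureTheory

noncomputable section

namespace EpochAdaGrad

/-- The decision space `ℝ^d` with its Euclidean norm. -/
abbrev Vec (d : ℕ) : Type := EuclideanSpace ℝ (Fin d)

/-- Real `d × d` matrices. -/
abbrev Mat (d : ℕ) : Type := Matrix (Fin d) (Fin d) ℝ

/-- The square root `G^{1/2}`: the square root function applied to the spectrum of the
symmetric positive semidefinite matrix `G`. -/
def msqrt {d : ℕ} (G : Mat d) : Mat d := cfc Real.sqrt G

/-- The inverse square root `G^{-1/2}` of a positive definite matrix. -/
def minvSqrt {d : ℕ} (G : Mat d) : Mat d := (msqrt G)⁻¹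

/-- `G_t = G_0 + ∑_{s=1}^t g_s g_sᵀ`. -/
def covar {d : ℕ} (G₀ : Mat d) (g : ℕ → Vec d) (t : ℕ) : Mat d :=
  G₀ + ∑ s ∈ Finset.Icc 1 t, Matrix.vecMulVec (g s).ofLp (g s).ofLp

/-- The squared norm `‖v‖_H² = vᵀ H v`. -/
def sqNorm {d : ℕ} (H : Mat d) (v : Vec d) : ℝ := v.ofLp ⬝ᵥ (H.mulVec v.ofLp)

/-- `z` is the projection of `y` onto `𝒦` in the norm `‖·‖_H`. For positive definite `H` and a
nonempty closed convex `𝒦` there is exactly one such `z`; for `𝒦 = ℝ^d` it is `y` itself. -/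
def IsProj {d : ℕ} (𝒦 : Set (Vec d)) (H : Mat d) (y z : Vec d) : Prop :=
  z ∈ 𝒦 ∧ IsMinOn (fun w => sqNorm H (w - y)) 𝒦 z

/-- `t 1, …, t K` are update points with `t 1 = 0` and `t K = T`. -/
structure IsUpdatePoints (K T : ℕ) (t : ℕ → ℕ) : Prop where
  one_le : 1 ≤ K
  first : t 1 = 0
  last : t K = T
  mono : ∀ k, 1 ≤ k → k < K → t k ≤ t (k + 1)

/-- `x 1, …, x (T + 1)` are the iterates of AdaGrad with step size `η` on the decision set `𝒦`,
against the convex losses `f 1, …, f T` with gradients `g s` at `x s`, where during the rounds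
`t k < s ≤ t (k + 1)` the preconditioner stays at `G_{t_k}^{-1/2}` and the projection is
taken in the norm of `G_{t_k}^{1/2}`. -/
structure IsRun {d : ℕ} (𝒦 : Set (Vec d)) (η : ℝ) (K T : ℕ) (t : ℕ → ℕ) (G₀ : Mat d)
    (f : ℕ → Vec d → ℝ) (g x : ℕ → Vec d) : Prop where
  init_mem : x 1 ∈ 𝒦
  convex : ∀ s ∈ Finset.Icc 1 T, ConvexOn ℝ 𝒦 (f s)
  grad : ∀ s ∈ Finset.Icc 1 T, HasGradientWithinAt (f s) (g s) 𝒦 (x s)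
  update : ∀ k, 1 ≤ k → k < K → ∀ s, t k < s → s ≤ t (k + 1) →
    IsProj 𝒦 (msqrt (covar G₀ g (t k)))
      (x s - η • WithLp.toLp 2 ((minvSqrt (covar G₀ g (t k))).mulVec (g s).ofLp)) (x (s + 1))

/-- `∑_{s=1}^T f_s(u)`. -/
def cumLoss {d : ℕ} (f : ℕ → Vec d → ℝ) (T : ℕ) (u : Vec d) : ℝ :=
  ∑ s ∈ Finset.Icc 1 T, f s u

/-- The regret relative to the comparator `u`. -/
def regretTo {d : ℕ} (f : ℕ → Vec d → ℝ) (x : ℕ → Vec d) (T : ℕ) (u : Vec d) : ℝ :=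
  ∑ s ∈ Finset.Icc 1 T, f s (x s) - cumLoss f T u

/-- The regret `R_T`, relative to the best fixed point of `𝒦`. -/
def regret {d : ℕ} (𝒦 : Set (Vec d)) (f : ℕ → Vec d → ℝ) (x : ℕ → Vec d) (T : ℕ) : ℝ :=
  ∑ s ∈ Finset.Icc 1 T, f s (x s) - ⨅ u : 𝒦, cumLoss f T u

/-- `A_k = G_{t_{k+1}} - G_{t_k}`. -/
def incr {d : ℕ} (G₀ : Mat d) (g : ℕ → Vec d) (t : ℕ → ℕ) (k : ℕ) : Mat d :=
  covar G₀ g (t (k + 1)) - covar G₀ g (t k)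

/-- `exp(-τ G^{1/2}) A exp(-τ G^{1/2})`. -/
def lyapIntegrand {d : ℕ} (G A : Mat d) (τ : ℝ) : Mat d :=
  NormedSpace.exp (-τ • msqrt G) * A * NormedSpace.exp (-τ • msqrt G)

/-- `∫_0^∞ exp(-τ G^{1/2}) A exp(-τ G^{1/2}) dτ`, entry by entry. -/
def lyap {d : ℕ} (G A : Mat d) : Mat d :=
  Matrix.of fun i j => ∫ τ in Ioi (0 : ℝ), lyapIntegrand G A τ i j

/-- `ε_k = tr (G_{t_k}^{-1/2} S_k G_{t_k}^{-1/2} A_k)`. -/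
def err {d : ℕ} (G₀ : Mat d) (g : ℕ → Vec d) (t : ℕ → ℕ) (k : ℕ) : ℝ :=
  (minvSqrt (covar G₀ g (t k)) * lyap (covar G₀ g (t k)) (incr G₀ g t k) *
    minvSqrt (covar G₀ g (t k)) * incr G₀ g t k).trace

/-- The event `E` holds with probability at least `1 - δ` (its complement has outer measure at
most `δ`, so `E` contains a measurable event of probability at least `1 - δ`). -/
def WithProb {Ω : Type*} [MeasurableSpace Ω] (P : Measure Ω) (δ : ℝ) (E : Ω → Prop) : Prop :=
  P {ω | ¬ E ω} ≤ ENNReal.ofReal δ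

end EpochAdaGrad

end

/-! Within an epoch the preconditioner $H=G_{t_k}^{1/2}$ is frozen, so the usual mirror-descent
inequality telescopes. When $H$ grows to $M=G_{t_{k+1}}^{1/2}$, operator monotonicity of the square
root bounds the extra potential by $D^2\operatorname{tr}(M-H)$, which telescopes over epochs
(`sum_loss_le`). What remains is $\sum_k\operatorname{tr}(H^{-1}A_k)$.

The integral $S$ solves $HS+SH=A$, where $A=M^2-H^2$. With $\Delta=M-H$, the difference $E=S-\Delta$
solves $HE+EH=\Delta^2$. Multiplying by $H^{-1}$ and taking traces gives
$\operatorname{tr}(H^{-1}A)=2\operatorname{tr}S=2\operatorname{tr}\Delta+\operatorname{tr}(\Delta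
H^{-1}\Delta)$. The first term telescopes, and the second is at most
$\epsilon_k=2\operatorname{tr}(SH^{-1}S)$ (`trace_inv_mul_le_add_err`).

If $A\preceq\beta H^2$, then $\epsilon_k\le\beta\operatorname{tr}S$, and $M\preceq\sqrt{1+\beta}\,H$
gives $2\operatorname{tr}S\le(\sqrt{1+\beta}+1)\operatorname{tr}\Delta$. So $\sum_k\epsilon_k$
telescopes to a multiple of $\operatorname{tr}G_T^{1/2}$ depending only on $\beta$; the factors
$\sqrt{\sigma_{\max}/\sigma_{\min}}\ge1$ and $\log T\ge\log2$ are inserted afterwards. -/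

namespace EpochAdaGrad

open Matrix

variable {d : ℕ}

/-! ### Matrix square roots and positivity. -/

theorem exists_diagonalization {G : Mat d} (hG : G.IsHermitian) :
    ∃ U : Mat d, ∃ l : Fin d → ℝ, Uᵀ * U = 1 ∧ U * Uᵀ = 1 ∧ G = U * diagonal l * Uᵀ ∧
      msqrt G = U * diagonal (fun i => √(l i)) * Uᵀ ∧
      (G.PosSemidef → ∀ i, 0 ≤ l i) ∧ (G.PosDef → ∀ i, 0 < l i) := by
  have hs : star (hG.eigenvectorUnitary : Mat d) = (hG.eigenvectorUnitary : Mat d)ᵀ := by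
    rw [star_eq_conjTranspose, conjTranspose_eq_transpose_of_trivial]
  refine ⟨hG.eigenvectorUnitary, hG.eigenvalues, ?_, ?_, ?_, ?_,
    fun h => hG.posSemidef_iff_eigenvalues_nonneg.mp h, fun h i => h.eigenvalues_pos i⟩
  · rw [← hs]; exact Unitary.coe_star_mul_self _
  · rw [← hs]; exact Unitary.coe_mul_star_self _
  · conv_lhs => rw [hG.spectral_theorem, Unitary.conjStarAlgAut_apply, hs]
    rfl
  · rw [msqrt, hG.cfc_eq, Matrix.IsHermitian.cfc, Unitary.conjStarAlgAut_apply, hs]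
    rfl

theorem msqrt_mul_self {G : Mat d} (hG : G.PosSemidef) : msqrt G * msqrt G = G := by
  obtain ⟨U, l, hU, -, hGd, hs, hl, -⟩ := exists_diagonalization hG.1
  have : U * diagonal (fun i => √(l i)) * Uᵀ * (U * diagonal (fun i => √(l i)) * Uᵀ) =
      U * diagonal (fun i => √(l i)) * (Uᵀ * U) * diagonal (fun i => √(l i)) * Uᵀ := by
    simp only [Matrix.mul_assoc]
  rw [hs, this, hU, Matrix.mul_one, Matrix.mul_assoc U, diagonal_mul_diagonal]
  simp_rw [Real.mul_self_sqrt (hl hG _)]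
  exact hGd.symm

theorem msqrt_posSemidef {G : Mat d} (hG : G.PosSemidef) : (msqrt G).PosSemidef := by
  obtain ⟨U, l, -, -, -, hs, -, -⟩ := exists_diagonalization hG.1
  rw [hs, ← conjTranspose_eq_transpose_of_trivial]
  exact PosSemidef.mul_mul_conjTranspose_same
    (PosSemidef.diagonal fun i => Real.sqrt_nonneg (l i)) U

theorem msqrt_posDef {G : Mat d} (hG : G.PosDef) : (msqrt G).PosDef := by
  obtain ⟨U, l, hU, hU', -, hs, -, hl⟩ := exists_diagonalization hG.1
  rw [hs, ← conjTranspose_eq_transpose_of_trivial]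
  refine PosDef.mul_mul_conjTranspose_same
    (PosDef.diagonal fun i => Real.sqrt_pos.2 (hl hG i)) ?_
  intro v w hvw
  have := congrArg (fun z => z ᵥ* Uᵀ) hvw
  simpa [vecMul_vecMul, hU'] using this

/-- By cyclicity the trace is that of $Q^{1/2}PQ^{1/2}\succeq0$. -/
theorem trace_mul_nonneg {P Q : Mat d} (hP : P.PosSemidef) (hQ : Q.PosSemidef) :
    0 ≤ (P * Q).trace := by
  rw [← msqrt_mul_self hQ, ← Matrix.mul_assoc, trace_mul_comm]
  have h := hP.conjTranspose_mul_mul_same (msqrt Q)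
  rw [(msqrt_posSemidef hQ).1.eq] at h
  simpa [Matrix.mul_assoc] using h.trace_nonneg

theorem trace_conj_nonneg {P X : Mat d} (hP : P.PosSemidef) (hX : X.IsHermitian) :
    0 ≤ (X * P * X).trace := by
  have h := hP.conjTranspose_mul_mul_same X
  rw [hX.eq] at h
  exact h.trace_nonneg

theorem mul_mul_same_posSemidef {P X : Mat d} (hP : P.PosSemidef) (hX : X.IsHermitian) :
    (X * P * X).PosSemidef := by
  have h := hP.conjTranspose_mul_mul_same X
  rwa [hX.eq] at h

/-- A symmetric solution of a Lyapunov equation with positive semidefinite right-hand side is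
positive semidefinite. -/
theorem posSemidef_of_lyapunov {L X : Mat d} (hL : L.PosDef) (hX : X.IsHermitian)
    (h : (L * X + X * L).PosSemidef) : X.PosSemidef := by
  rw [hX.posSemidef_iff_eigenvalues_nonneg]
  intro i
  by_contra! hi
  set v : Fin d → ℝ := ⇑(hX.eigenvectorBasis i)
  have hv0 : v ≠ 0 := (WithLp.ofLp_eq_zero 2).ne.2 <| hX.eigenvectorBasis.orthonormal.ne_zero i
  have hv : X *ᵥ v = hX.eigenvalues i • v := hX.mulVec_eigenvectorBasis i
  have hv' : v ᵥ* X = hX.eigenvalues i • v := by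
    rw [← hv, ← mulVec_transpose, ← conjTranspose_eq_transpose_of_trivial, hX.eq]
  have h1 := h.dotProduct_mulVec_nonneg v
  have h2 := hL.dotProduct_mulVec_pos hv0
  simp only [star_trivial] at h1 h2
  -- At an eigenvector of $X$ the form of $LX+XL$ has the sign of the eigenvalue, since $L\succ0$.
  have h3 : v ⬝ᵥ ((L * X + X * L) *ᵥ v) = 2 * hX.eigenvalues i * (v ⬝ᵥ (L *ᵥ v)) := by
    rw [add_mulVec, dotProduct_add, ← mulVec_mulVec, hv, ← mulVec_mulVec, dotProduct_mulVec v X,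
      hv', mulVec_smul, dotProduct_smul, smul_dotProduct, smul_eq_mul]
    ring
  rw [h3] at h1
  have hi' : hX.eigenvalues i < 0 := hi
  nlinarith

/-- The matrix square root is operator monotone. -/
theorem sub_posSemidef_of_mul_self {P Q : Mat d} (hP : P.PosDef) (hQ : Q.PosSemidef)
    (h : (P * P - Q * Q).PosSemidef) : (P - Q).PosSemidef := by
  refine posSemidef_of_lyapunov (hP.add_posSemidef hQ) (hP.1.sub hQ.1) ?_
  -- Symmetrizing cancels the commutator, so $P-Q$ solves a Lyapunov equation with coefficient
  -- $P+Q$.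
  have : (P + Q) * (P - Q) + (P - Q) * (P + Q) = (P * P - Q * Q) + (P * P - Q * Q) := by
    noncomm_ring
  rw [this]
  exact h.add h

/-! ### Trace inequalities for a single epoch. -/

theorem inv_mul_self {H : Mat d} (hH : H.PosDef) : H⁻¹ * H = 1 :=
  nonsing_inv_mul _ ((isUnit_iff_isUnit_det _).1 hH.isUnit)

theorem mul_inv_self {H : Mat d} (hH : H.PosDef) : H * H⁻¹ = 1 :=
  mul_nonsing_inv _ ((isUnit_iff_isUnit_det _).1 hH.isUnit)

theorem trace_inv_mul_lyapunov {H S A : Mat d} (hH : H.PosDef) (hS : H * S + S * H = A) :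
    (H⁻¹ * A).trace = 2 * S.trace := by
  rw [← hS, Matrix.mul_add, trace_add, ← Matrix.mul_assoc, inv_mul_self hH, Matrix.one_mul,
    trace_mul_comm H⁻¹, Matrix.mul_assoc, mul_inv_self hH, Matrix.mul_one]
  ring

theorem err_eq_trace {H S A : Mat d} (hH : H.PosDef) (hS : H * S + S * H = A) :
    (H⁻¹ * S * H⁻¹ * A).trace = 2 * (S * H⁻¹ * S).trace := by
  have h1 : H⁻¹ * S * H⁻¹ * (H * S) = H⁻¹ * S * (H⁻¹ * H) * S := by
    simp only [Matrix.mul_assoc]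
  have h2 : H⁻¹ * S * H⁻¹ * (S * H) = (H⁻¹ * S * H⁻¹ * S) * H := by
    simp only [Matrix.mul_assoc]
  have h3 : H * (H⁻¹ * S * H⁻¹ * S) = (H * H⁻¹) * (S * H⁻¹ * S) := by
    simp only [Matrix.mul_assoc]
  rw [← hS, Matrix.mul_add, trace_add, h1, h2, trace_mul_comm _ H, h3, inv_mul_self hH,
    mul_inv_self hH, Matrix.one_mul, Matrix.mul_one, Matrix.mul_assoc, trace_mul_comm H⁻¹,
    Matrix.mul_assoc S S, trace_mul_comm S (S * H⁻¹)]
  ring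

theorem trace_inv_mul_le_add_err {H M S A : Mat d} (hH : H.PosDef)
    (hMH : (M - H).PosSemidef) (hA : M * M - H * H = A) (hSh : S.IsHermitian)
    (hS : H * S + S * H = A) :
    (H⁻¹ * A).trace ≤ 2 * M.trace - 2 * H.trace + (H⁻¹ * S * H⁻¹ * A).trace := by
  set Δ := M - H with hΔ
  set E := S - Δ with hE
  have hEh : E.IsHermitian := hSh.sub hMH.1
  have hM : M = H + Δ := by rw [hΔ]; abel
  have hSE : S = Δ + E := by rw [hE]; abel
  have hEl : H * E + E * H = Δ * Δ := by
    have : H * S + S * H = M * M - H * H := by rw [hS, hA]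
    rw [hSE, hM] at this
    have h2 : H * E + E * H = H * (Δ + E) + (Δ + E) * H - (H * Δ + Δ * H) := by noncomm_ring
    rw [h2, this]; noncomm_ring
  have hHi := hH.inv.posSemidef
  have htS : 2 * S.trace = 2 * Δ.trace + (H⁻¹ * (Δ * Δ)).trace := by
    rw [trace_inv_mul_lyapunov hH hEl, hSE, trace_add]; ring
  have hΔt : Δ.trace = M.trace - H.trace := by rw [hΔ, trace_sub]
  -- Conjugating $HE+EH=\Delta^2$ by $H^{-1}$ gives $EH^{-1}+H^{-1}E=H^{-1}\Delta^2H^{-1}$, so the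
  -- cross term is a trace of two positive semidefinite factors.
  have hcross : 0 ≤ (Δ * H⁻¹ * E + E * H⁻¹ * Δ).trace := by
    have hc : (Δ * H⁻¹ * E + E * H⁻¹ * Δ).trace = (Δ * (H⁻¹ * (Δ * Δ) * H⁻¹)).trace := by
      have : H⁻¹ * (H * E + E * H) * H⁻¹ = (H⁻¹ * H) * E * H⁻¹ + H⁻¹ * E * (H * H⁻¹) := by
        noncomm_ring
      rw [← hEl, this, inv_mul_self hH, mul_inv_self hH, Matrix.one_mul, Matrix.mul_one,
        Matrix.mul_add, trace_add, trace_add, trace_mul_comm (E * H⁻¹) Δ, ← Matrix.mul_assoc,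
        ← Matrix.mul_assoc, add_comm]
    rw [hc]
    refine trace_mul_nonneg hMH (mul_mul_same_posSemidef ?_ hH.inv.1)
    have := posSemidef_conjTranspose_mul_self Δ
    rwa [hMH.1.eq] at this
  have hEE := trace_conj_nonneg hHi hEh
  have hΔΔ := trace_conj_nonneg hHi hMH.1
  have hexp : (S * H⁻¹ * S).trace = (Δ * H⁻¹ * Δ).trace +
      (Δ * H⁻¹ * E + E * H⁻¹ * Δ).trace + (E * H⁻¹ * E).trace := by
    rw [← trace_add, ← trace_add, hSE]; congr 1; noncomm_ring
  have hcyc : (H⁻¹ * (Δ * Δ)).trace = (Δ * H⁻¹ * Δ).trace := by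
    rw [← Matrix.mul_assoc, trace_mul_comm, Matrix.mul_assoc]
  rw [trace_inv_mul_lyapunov hH hS, err_eq_trace hH hS]
  linarith

/-- Both bounds pair $\beta H^2-A\succeq0$ with a positive semidefinite matrix: $H^{-1}SH^{-1}$ for
the first, $H^{-1}$ for the second. -/
theorem trace_lyapunov_le {H S A : Mat d} {β : ℝ} (hH : H.PosDef)
    (hSh : S.IsHermitian) (hS : H * S + S * H = A) (hA : A.PosSemidef)
    (hβ : (β • (H * H) - A).PosSemidef) :
    (H⁻¹ * S * H⁻¹ * A).trace ≤ β * S.trace ∧ 2 * S.trace ≤ β * H.trace := by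
  have hSp : S.PosSemidef := posSemidef_of_lyapunov hH hSh (by rwa [hS])
  constructor
  · have h := trace_mul_nonneg (mul_mul_same_posSemidef hSp hH.inv.1) hβ
    have h1 : H⁻¹ * S * H⁻¹ * (H * H) = H⁻¹ * (S * ((H⁻¹ * H) * H)) := by
      simp only [Matrix.mul_assoc]
    rw [Matrix.mul_sub, trace_sub, Matrix.mul_smul, trace_smul, h1, inv_mul_self hH,
      Matrix.one_mul, trace_mul_comm, Matrix.mul_assoc, mul_inv_self hH, Matrix.mul_one,
      smul_eq_mul] at h
    linarith
  · have h := trace_mul_nonneg hH.inv.posSemidef hβ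
    rw [Matrix.mul_sub, trace_sub, Matrix.mul_smul, trace_smul, ← Matrix.mul_assoc,
      inv_mul_self hH, Matrix.one_mul, trace_inv_mul_lyapunov hH hS, smul_eq_mul] at h
    linarith

/-- With $Y=H^{-1}\Delta$, adding the traces of $Y^\top(cH-\Delta)Y\succeq0$ and
$(Y-c)^\top\Delta(Y-c)\succeq0$ cancels the cubic term and leaves $c$ times the claim. -/
theorem trace_mul_inv_mul_le {H Δ : Mat d} {c : ℝ} (hc : 0 < c) (hH : H.PosDef)
    (hΔ : Δ.PosSemidef) (h : (c • H - Δ).PosSemidef) :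
    (Δ * H⁻¹ * Δ).trace ≤ c * Δ.trace := by
  have hT : (H⁻¹)ᴴ = H⁻¹ := hH.inv.1.eq
  have hΔT : Δᴴ = Δ := hΔ.1.eq
  have h1 := (h.conjTranspose_mul_mul_same (H⁻¹ * Δ)).trace_nonneg
  have h2 := (hΔ.conjTranspose_mul_mul_same (H⁻¹ * Δ - c • 1)).trace_nonneg
  rw [conjTranspose_mul, hT, hΔT] at h1
  rw [conjTranspose_sub, conjTranspose_mul, hT, hΔT, conjTranspose_smul, conjTranspose_one,
    star_trivial] at h2
  have e1 : Δ * H⁻¹ * (c • H - Δ) * (H⁻¹ * Δ) =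
      c • (Δ * (H⁻¹ * H) * H⁻¹ * Δ) - Δ * H⁻¹ * Δ * H⁻¹ * Δ := by
    simp only [Matrix.mul_sub, Matrix.sub_mul, Matrix.mul_smul, Matrix.smul_mul, Matrix.mul_assoc]
  have e2 : (Δ * H⁻¹ - c • 1) * Δ * (H⁻¹ * Δ - c • 1) =
      Δ * H⁻¹ * Δ * H⁻¹ * Δ - (2 * c) • (Δ * H⁻¹ * Δ) + c ^ 2 • Δ := by
    simp only [Matrix.mul_sub, Matrix.sub_mul, Matrix.mul_smul, Matrix.smul_mul, Matrix.mul_assoc,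
      Matrix.mul_one, Matrix.one_mul]
    module
  rw [e1, inv_mul_self hH, Matrix.mul_one, trace_sub, trace_smul, smul_eq_mul] at h1
  rw [e2, trace_add, trace_sub, trace_smul, trace_smul, smul_eq_mul, smul_eq_mul] at h2
  have : 0 ≤ c * (c * Δ.trace - (Δ * H⁻¹ * Δ).trace) := by nlinarith
  linarith [nonneg_of_mul_nonneg_right this hc]

theorem trace_lyapunov_le_sub {H M S A : Mat d} {β : ℝ} (hβ : 0 < β) (hH : H.PosDef)
    (hM : M.PosDef) (hMH : (M - H).PosSemidef) (hA : M * M - H * H = A)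
    (hS : H * S + S * H = A) (hAβ : (β • (H * H) - A).PosSemidef) :
    2 * S.trace ≤ (√(1 + β) + 1) * (M.trace - H.trace) := by
  set c := √(1 + β)
  have hc2 : c * c = 1 + β := Real.mul_self_sqrt (by positivity)
  have hc1 : 1 < c := by
    have : 0 ≤ c := Real.sqrt_nonneg _
    nlinarith
  have hcH : (c • H).PosDef := hH.smul (by linarith)
  -- $M^2=H^2+A\preceq(1+\beta)H^2$, and the square root preserves this order.
  have hcM : (c • H - M).PosSemidef := by
    refine sub_posSemidef_of_mul_self hcH hM.posSemidef ?_
    have : (c • H) * (c • H) - M * M = β • (H * H) - A := by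
      rw [← hA, Matrix.smul_mul, Matrix.mul_smul, smul_smul, hc2]; module
    rwa [this]
  have h1 := trace_mul_inv_mul_le (c := c - 1) (by linarith) hH hMH (by
    have : (c - 1) • H - (M - H) = c • H - M := by module
    rwa [this])
  have e1 : H⁻¹ * A = H⁻¹ * H * (M - H) + H⁻¹ * (M - H) * H + H⁻¹ * (M - H) * (M - H) := by
    rw [← hA]; noncomm_ring
  have e2 : 2 * S.trace = 2 * (M - H).trace + ((M - H) * H⁻¹ * (M - H)).trace := by
    rw [← trace_inv_mul_lyapunov hH hS, e1, trace_add, trace_add, inv_mul_self hH, Matrix.one_mul,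
      trace_mul_comm _ H, ← Matrix.mul_assoc, mul_inv_self hH, Matrix.one_mul,
      trace_mul_comm (H⁻¹ * (M - H)), ← Matrix.mul_assoc]
    ring
  rw [trace_sub] at e2 h1
  linarith

/-! ### The Lyapunov integral. -/

theorem lyapIntegrand_eq {G U A : Mat d} {h : Fin d → ℝ} (hU : Uᵀ * U = 1)
    (hU' : U * Uᵀ = 1) (hH : msqrt G = U * diagonal h * Uᵀ) (τ : ℝ) :
    lyapIntegrand G A τ =
      U * of (fun a b => (Uᵀ * A * U) a b * Real.exp (-(h a + h b) * τ)) * Uᵀ := by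
  have hinv : U⁻¹ = Uᵀ := inv_eq_right_inv hU'
  have hunit : IsUnit U := ⟨⟨U, Uᵀ, hU', hU⟩, rfl⟩
  have hexp : NormedSpace.exp (-τ • msqrt G) =
      U * diagonal (fun a => Real.exp (-τ * h a)) * Uᵀ := by
    have : -τ • msqrt G = U * diagonal (fun a => -τ * h a) * U⁻¹ := by
      rw [hinv, hH, ← Matrix.smul_mul, ← Matrix.mul_smul, ← diagonal_smul]; rfl
    rw [this, Matrix.exp_conj _ _ hunit, Matrix.exp_diagonal, hinv]
    congr 3
    ext a
    rw [Pi.coe_exp, Real.exp_eq_exp_ℝ]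
  rw [lyapIntegrand, hexp]
  have : of (fun a b => (Uᵀ * A * U) a b * Real.exp (-(h a + h b) * τ)) =
      diagonal (fun a => Real.exp (-τ * h a)) * (Uᵀ * A * U) *
        diagonal (fun a => Real.exp (-τ * h a)) := by
    ext a b
    rw [mul_diagonal, diagonal_mul, of_apply, show -(h a + h b) * τ = -τ * h a + -τ * h b by ring,
      Real.exp_add]
    ring
  rw [this]
  simp only [Matrix.mul_assoc]

/-- In an eigenbasis of $G^{1/2}$ each entry decays like $e^{-(h_a+h_b)\tau}$, whose integral is
$1/(h_a+h_b)$. -/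
theorem integrableOn_lyapIntegrand_and_lyap_eq {G A U : Mat d} {h : Fin d → ℝ}
    (hU : Uᵀ * U = 1) (hU' : U * Uᵀ = 1) (hH : msqrt G = U * diagonal h * Uᵀ)
    (hpos : ∀ i, 0 < h i) :
    (∀ i j, IntegrableOn (fun τ => lyapIntegrand G A τ i j) (Ioi 0)) ∧
      lyap G A = U * of (fun a b => (Uᵀ * A * U) a b / (h a + h b)) * Uᵀ := by
  have hfun : ∀ i j, (fun τ => lyapIntegrand G A τ i j) = fun τ =>
      ∑ b, ∑ a, U i a * (Uᵀ * A * U) a b * U j b * Real.exp (-(h a + h b) * τ) := by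
    intro i j
    ext τ
    rw [lyapIntegrand_eq hU hU' hH, mul_apply]
    refine Finset.sum_congr rfl fun b _ => ?_
    rw [mul_apply, Finset.sum_mul]
    refine Finset.sum_congr rfl fun a _ => ?_
    rw [of_apply, transpose_apply]
    ring
  have hneg : ∀ a b, -(h a + h b) < 0 := fun a b => by linarith [hpos a, hpos b]
  have hint : ∀ i j a b, IntegrableOn
      (fun τ => U i a * (Uᵀ * A * U) a b * U j b * Real.exp (-(h a + h b) * τ)) (Ioi 0) :=
    fun i j a b => (integrableOn_exp_mul_Ioi (hneg a b) 0).const_mul _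
  constructor
  · intro i j
    rw [hfun]
    exact integrable_finsetSum _ fun b _ => integrable_finsetSum _ fun a _ => hint i j a b
  · ext i j
    rw [lyap, of_apply, hfun,
      integral_finsetSum _ fun b _ => integrable_finsetSum _ fun a _ => hint i j a b, mul_apply]
    refine Finset.sum_congr rfl fun b _ => ?_
    rw [integral_finsetSum _ fun a _ => hint i j a b, mul_apply, Finset.sum_mul]
    refine Finset.sum_congr rfl fun a _ => ?_
    rw [integral_const_mul, integral_exp_mul_Ioi (hneg a b), of_apply, transpose_apply]
    have : h a + h b ≠ 0 := by linarith [hneg a b]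
    rw [mul_zero, Real.exp_zero, neg_div_neg_eq]
    ring

theorem integrableOn_lyapIntegrand {G : Mat d} (hG : G.PosDef) (A : Mat d) (i j : Fin d) :
    IntegrableOn (fun τ => lyapIntegrand G A τ i j) (Ioi 0) := by
  obtain ⟨U, l, hU, hU', -, hs, -, hl⟩ := exists_diagonalization hG.1
  exact (integrableOn_lyapIntegrand_and_lyap_eq hU hU' hs
    fun i => Real.sqrt_pos.2 (hl hG i)).1 i j

theorem lyap_spec {G A : Mat d} (hG : G.PosDef) (hA : A.IsHermitian) :
    (lyap G A).IsHermitian ∧ msqrt G * lyap G A + lyap G A * msqrt G = A := by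
  obtain ⟨U, l, hU, hU', -, hs, -, hl⟩ := exists_diagonalization hG.1
  have hpos := fun i => Real.sqrt_pos.2 (hl hG i)
  have hS := (integrableOn_lyapIntegrand_and_lyap_eq (A := A) hU hU' hs hpos).2
  set h : Fin d → ℝ := fun i => √(l i)
  set Y : Mat d := of (fun a b => (Uᵀ * A * U) a b / (h a + h b)) with hY
  have hAt : Aᵀ = A := by rw [← conjTranspose_eq_transpose_of_trivial, hA.eq]
  have hUAU : (Uᵀ * A * U)ᵀ = Uᵀ * A * U := by
    simp [hAt, Matrix.mul_assoc]
  constructor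
  · have hYt : Yᵀ = Y := by
      ext a b
      have := congrFun (congrFun hUAU a) b
      rw [transpose_apply] at this
      rw [transpose_apply, hY, of_apply, of_apply, this, add_comm]
    rw [hS, Matrix.IsHermitian, conjTranspose_eq_transpose_of_trivial, transpose_mul, transpose_mul,
      hYt, transpose_transpose, Matrix.mul_assoc]
  · have hYl : diagonal h * Y + Y * diagonal h = Uᵀ * A * U := by
      ext a b
      have : h a + h b ≠ 0 := (add_pos (hpos a) (hpos b)).ne'
      rw [Matrix.add_apply, diagonal_mul, mul_diagonal, hY, of_apply]
      field_simp
    have e : U * diagonal h * Uᵀ * (U * Y * Uᵀ) + U * Y * Uᵀ * (U * diagonal h * Uᵀ) =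
        U * (diagonal h * ((Uᵀ * U) * Y) + Y * ((Uᵀ * U) * diagonal h)) * Uᵀ := by
      simp only [Matrix.mul_assoc, Matrix.mul_add, Matrix.add_mul]
    have e2 : U * (Uᵀ * A * U) * Uᵀ = (U * Uᵀ) * A * (U * Uᵀ) := by
      simp only [Matrix.mul_assoc]
    rw [hS, hs, e, hU, Matrix.one_mul, Matrix.one_mul, hYl, e2, hU', Matrix.one_mul, Matrix.mul_one]

/-! ### Weighted norms, projection and the one-round inequality. -/

theorem sqNorm_nonneg {H : Mat d} (hH : H.PosSemidef) (v : Vec d) : 0 ≤ sqNorm H v :=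
  hH.dotProduct_mulVec_nonneg v.ofLp

theorem sqNorm_add_smul {H : Mat d} (hH : H.IsHermitian) (v w : Vec d) (c : ℝ) :
    sqNorm H (v + c • w) =
      sqNorm H v + 2 * c * (v.ofLp ⬝ᵥ (H *ᵥ w.ofLp)) + c ^ 2 * sqNorm H w := by
  have hs : w.ofLp ⬝ᵥ (H *ᵥ v.ofLp) = v.ofLp ⬝ᵥ (H *ᵥ w.ofLp) := by
    rw [dotProduct_comm, dotProduct_mulVec, ← mulVec_transpose,
      ← conjTranspose_eq_transpose_of_trivial, hH.eq, dotProduct_comm]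
  simp only [sqNorm, WithLp.ofLp_add, WithLp.ofLp_smul, mulVec_add, mulVec_smul, dotProduct_add,
    add_dotProduct, smul_dotProduct, dotProduct_smul, smul_eq_mul, hs]
  ring

theorem sqNorm_sub_matrix (P Q : Mat d) (v : Vec d) :
    sqNorm (P - Q) v = sqNorm P v - sqNorm Q v := by
  simp only [sqNorm, sub_mulVec, dotProduct_sub]

/-- Row-wise Cauchy–Schwarz for $R=P^{1/2}$, whose squared Frobenius norm is $\operatorname{tr}P$.
-/
theorem sqNorm_le_norm_sq_mul_trace {P : Mat d} (hP : P.PosSemidef) (v : Vec d) :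
    sqNorm P v ≤ ‖v‖ ^ 2 * P.trace := by
  have hR := msqrt_mul_self hP
  have hRh := (msqrt_posSemidef hP).1
  set R := msqrt P
  have hRt : Rᵀ = R := by rw [← conjTranspose_eq_transpose_of_trivial, hRh.eq]
  have h1 : sqNorm P v = ∑ i, (∑ j, R i j * v j) ^ 2 := by
    rw [sqNorm, ← hR, ← mulVec_mulVec, dotProduct_mulVec, ← mulVec_transpose, hRt]
    simp [dotProduct, mulVec, sq]
  have h2 : P.trace = ∑ i, ∑ j, R i j ^ 2 := by
    rw [← hR, trace]
    refine Finset.sum_congr rfl fun i _ => ?_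
    rw [diag_apply, mul_apply]
    refine Finset.sum_congr rfl fun j _ => ?_
    rw [sq, show R j i = R i j from congrFun (congrFun hRt i) j]
  rw [h1, h2, EuclideanSpace.real_norm_sq_eq, mul_comm, Finset.sum_mul]
  exact Finset.sum_le_sum fun i _ => Finset.sum_mul_sq_le_sq_mul_sq _ _ _

theorem sqNorm_proj_sub_le {𝒦 : Set (Vec d)} (hK : Convex ℝ 𝒦) {H : Mat d} (hH : H.PosSemidef)
    {y z u : Vec d} (hz : IsProj 𝒦 H y z) (hu : u ∈ 𝒦) :
    sqNorm H (z - u) ≤ sqNorm H (y - u) := by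
  set b := (z - y).ofLp ⬝ᵥ (H *ᵥ (u - z).ofLp)
  have hq := sqNorm_nonneg hH (u - z)
  have key : ∀ c : ℝ, 0 < c → c ≤ 1 → 0 ≤ 2 * b + c * sqNorm H (u - z) := by
    intro c hc hc1
    have hmem : z + c • (u - z) ∈ 𝒦 := hK.add_smul_sub_mem hz.1 hu ⟨hc.le, hc1⟩
    have h := hz.2 hmem
    simp only [mem_ofPred_eq] at h
    rw [show z + c • (u - z) - y = (z - y) + c • (u - z) by abel, sqNorm_add_smul hH.1] at h
    have : 0 ≤ c * (2 * b + c * sqNorm H (u - z)) := by linarith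
    exact nonneg_of_mul_nonneg_right this hc
  have hb : 0 ≤ b := by
    by_contra! hb
    have hpos : 0 < sqNorm H (u - z) + 1 - b := by linarith
    -- If $b<0$, this step length lies in $(0,1]$ and makes the quadratic term at most $-b$, forcing
    -- $2b-b\ge0$.
    have h := key (-b / (sqNorm H (u - z) + 1 - b)) (div_pos (by linarith) hpos)
      ((div_le_one hpos).2 (by linarith))
    rw [div_mul_eq_mul_div] at h
    have h2 : -b * sqNorm H (u - z) / (sqNorm H (u - z) + 1 - b) ≤ -b := by
      rw [div_le_iff₀ hpos]; nlinarith
    linarith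
  have e1 : sqNorm H (y - u) = sqNorm H (z - y) + 2 * b + sqNorm H (u - z) := by
    have h := sqNorm_add_smul hH.1 (z - y) (u - z) 1
    have h2 := sqNorm_add_smul hH.1 0 (y - u) (-1)
    rw [show z - y + (1 : ℝ) • (u - z) = 0 + (-1 : ℝ) • (y - u) by module, h2] at h
    simp only [WithLp.ofLp_zero, zero_dotProduct, sqNorm] at h
    simp only [sqNorm]
    linarith
  have e2 : sqNorm H (z - u) = sqNorm H (u - z) := by
    have h2 := sqNorm_add_smul hH.1 0 (z - u) (-1)
    rw [show 0 + (-1 : ℝ) • (z - u) = u - z by module] at h2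
    simp only [WithLp.ofLp_zero, zero_dotProduct, sqNorm] at h2
    simp only [sqNorm]
    linarith
  have := sqNorm_nonneg hH (z - y)
  linarith

/-- Restriction to the segment from $x$ to $u$ reduces this to the slope inequality on $[0,1]$; the
segment stays in $\mathcal K$, so a gradient within $\mathcal K$ suffices. -/
theorem sub_le_of_hasGradientWithinAt {𝒦 : Set (Vec d)} {f : Vec d → ℝ} {g x u : Vec d}
    (hf : ConvexOn ℝ 𝒦 f) (hg : HasGradientWithinAt f g 𝒦 x) (hx : x ∈ 𝒦) (hu : u ∈ 𝒦) :
    f x - f u ≤ g.ofLp ⬝ᵥ (x - u).ofLp := by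
  set γ : ℝ → Vec d := fun τ => x + τ • (u - x) with hγ
  have hmaps : MapsTo γ (Icc 0 1) 𝒦 := fun τ hτ => hf.1.add_smul_sub_mem hx hu hτ
  have hconv : ConvexOn ℝ (Icc (0 : ℝ) 1) (f ∘ γ) := by
    refine ⟨convex_Icc 0 1, fun a ha b hb p q hp hq hpq => ?_⟩
    have e : γ (p • a + q • b) = p • γ a + q • γ b := by
      simp only [hγ, smul_eq_mul]
      have : q = 1 - p := by linarith
      subst this
      module
    simp only [Function.comp_apply, e]
    exact hf.2 (hmaps ha) (hmaps hb) hp hq hpq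
  have hγd : HasDerivWithinAt γ (u - x) (Icc 0 1) 0 := by
    have := ((hasDerivWithinAt_id (0 : ℝ) (Icc 0 1)).smul_const (u - x)).const_add x
    simpa [hγ] using this
  have hγ0 : γ 0 = x := by simp [hγ]
  have hγ1 : γ 1 = u := by simp [hγ]
  have hfd := hasGradientWithinAt_iff_hasFDerivWithinAt.1 hg
  rw [← hγ0] at hfd
  have hd := hfd.comp_hasDerivWithinAt 0 hγd hmaps
  have h := hconv.le_slope_of_hasDerivWithinAt (by simp) (by simp) zero_lt_one hd
  rw [slope_def_field, Function.comp_apply, Function.comp_apply, hγ0, hγ1,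
    InnerProductSpace.toDual_apply_apply, EuclideanSpace.inner_eq_star_dotProduct, star_trivial] at h
  have e : g.ofLp ⬝ᵥ (x - u).ofLp = - ((u - x).ofLp ⬝ᵥ g.ofLp) := by
    rw [dotProduct_comm, ← neg_dotProduct, ← WithLp.ofLp_neg, neg_sub]
  rw [e]
  linarith

theorem loss_sub_le {𝒦 : Set (Vec d)} (hK : Convex ℝ 𝒦) {η : ℝ} (hη : 0 < η)
    {H : Mat d} (hH : H.PosDef) {f : Vec d → ℝ} {g x z u : Vec d}
    (hf : ConvexOn ℝ 𝒦 f) (hg : HasGradientWithinAt f g 𝒦 x) (hx : x ∈ 𝒦) (hu : u ∈ 𝒦)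
    (hz : IsProj 𝒦 H (x - η • WithLp.toLp 2 (H⁻¹ *ᵥ g.ofLp)) z) :
    f x - f u ≤ 1 / (2 * η) * (sqNorm H (x - u) - sqNorm H (z - u)) +
      η / 2 * (H⁻¹ * vecMulVec g.ofLp g.ofLp).trace := by
  have h1 := sub_le_of_hasGradientWithinAt hf hg hx hu
  have h2 := sqNorm_proj_sub_le hK hH.posSemidef hz hu
  have e := sqNorm_add_smul hH.1 (x - u) (WithLp.toLp 2 (H⁻¹ *ᵥ g.ofLp)) (-η)
  rw [show x - u + (-η) • WithLp.toLp 2 (H⁻¹ *ᵥ g.ofLp) =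
    x - η • WithLp.toLp 2 (H⁻¹ *ᵥ g.ofLp) - u by module] at e
  have e1 : H *ᵥ (H⁻¹ *ᵥ g.ofLp) = g.ofLp := by
    rw [mulVec_mulVec, mul_inv_self hH, one_mulVec]
  have e2 : sqNorm H (WithLp.toLp 2 (H⁻¹ *ᵥ g.ofLp)) = (H⁻¹ *ᵥ g.ofLp) ⬝ᵥ g.ofLp := by
    rw [sqNorm, e1]
  rw [e, e2, e1, dotProduct_comm (x - u).ofLp g.ofLp] at h2
  rw [mul_vecMulVec, trace_vecMulVec]
  set q := (H⁻¹ *ᵥ g.ofLp) ⬝ᵥ g.ofLp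
  set r := g.ofLp ⬝ᵥ (x - u).ofLp
  have : r ≤ 1 / (2 * η) * (sqNorm H (x - u) - sqNorm H (z - u)) + η / 2 * q := by
    rw [← mul_le_mul_iff_right₀ (show 0 < 2 * η by positivity)]
    have : 2 * η * (1 / (2 * η) * (sqNorm H (x - u) - sqNorm H (z - u)) + η / 2 * q) =
      sqNorm H (x - u) - sqNorm H (z - u) + η ^ 2 * q := by field_simp
    rw [this]
    linarith
  linarith

/-! ### Monotonicity of the matrices $G_t$, and the epochs. -/

theorem vecMulVec_posSemidef (v : Fin d → ℝ) : (vecMulVec v v).PosSemidef := by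
  simpa using posSemidef_vecMulVec_self_star v

theorem covar_sub {G₀ : Mat d} {g : ℕ → Vec d} {a b : ℕ} (h : a ≤ b) :
    covar G₀ g b - covar G₀ g a =
      ∑ s ∈ Finset.Ioc a b, vecMulVec (g s).ofLp (g s).ofLp := by
  have : Finset.Icc 1 b = Finset.Icc 1 a ∪ Finset.Ioc a b := by
    ext s; simp only [Finset.mem_union, Finset.mem_Icc, Finset.mem_Ioc]; omega
  rw [covar, covar, this, Finset.sum_union]
  · abel
  · rw [Finset.disjoint_left]
    intro s; simp only [Finset.mem_Icc, Finset.mem_Ioc]; omega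

theorem covar_sub_posSemidef {G₀ : Mat d} {g : ℕ → Vec d} {a b : ℕ} (h : a ≤ b) :
    (covar G₀ g b - covar G₀ g a).PosSemidef := by
  rw [covar_sub h]
  exact posSemidef_sum _ fun s _ => vecMulVec_posSemidef _

theorem covar_posDef {G₀ : Mat d} (hG : G₀.PosDef) (g : ℕ → Vec d) (a : ℕ) :
    (covar G₀ g a).PosDef :=
  hG.add_posSemidef (posSemidef_sum _ fun _ _ => vecMulVec_posSemidef _)

theorem msqrt_covar_sub_posSemidef {G₀ : Mat d} (hG : G₀.PosDef) (g : ℕ → Vec d) {a b : ℕ}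
    (h : a ≤ b) : (msqrt (covar G₀ g b) - msqrt (covar G₀ g a)).PosSemidef := by
  refine sub_posSemidef_of_mul_self (msqrt_posDef (covar_posDef hG g b))
    (msqrt_posSemidef (covar_posDef hG g a).posSemidef) ?_
  rw [msqrt_mul_self (covar_posDef hG g b).posSemidef,
    msqrt_mul_self (covar_posDef hG g a).posSemidef]
  exact covar_sub_posSemidef h

theorem IsUpdatePoints.monotone {K T : ℕ} {t : ℕ → ℕ} (ht : IsUpdatePoints K T t) {k j : ℕ}
    (hk : 1 ≤ k) (hkj : k ≤ j) (hj : j ≤ K) : t k ≤ t j := by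
  induction j, hkj using Nat.le_induction with
  | base => exact le_rfl
  | succ j hkj ih => exact (ih (by omega)).trans (ht.mono j (by omega) (by omega))

theorem IsUpdatePoints.exists_epoch {K T : ℕ} {t : ℕ → ℕ} (ht : IsUpdatePoints K T t) {s : ℕ}
    (hs : 0 < s) (hsT : s ≤ T) : ∃ k, 1 ≤ k ∧ k < K ∧ t k < s ∧ s ≤ t (k + 1) := by
  suffices ∀ j, 1 ≤ j → j ≤ K → s ≤ t j → ∃ k, 1 ≤ k ∧ k < K ∧ t k < s ∧ s ≤ t (k + 1) from
    this K ht.one_le le_rfl (hsT.trans_eq ht.last.symm)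
  intro j hj
  induction j, hj using Nat.le_induction with
  | base => intro _ h; rw [ht.first] at h; omega
  | succ j hj ih =>
    intro hjK h
    by_cases hsj : s ≤ t j
    · exact ih (by omega) hsj
    · exact ⟨j, hj, by omega, by omega, h⟩

theorem IsRun.mem {𝒦 : Set (Vec d)} {η : ℝ} {K T : ℕ} {t : ℕ → ℕ} {G₀ : Mat d}
    {f : ℕ → Vec d → ℝ} {g x : ℕ → Vec d} (ht : IsUpdatePoints K T t)
    (hrun : IsRun 𝒦 η K T t G₀ f g x) {s : ℕ} (hs : 1 ≤ s) (hsT : s ≤ T) : x s ∈ 𝒦 := by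
  rcases Nat.lt_or_ge 1 s with h | h
  · obtain ⟨r, rfl⟩ : ∃ r, s = r + 1 := ⟨s - 1, by omega⟩
    obtain ⟨k, hk, hkK, h1, h2⟩ := ht.exists_epoch (s := r) (by omega) (by omega)
    exact (hrun.update k hk hkK r h1 h2).1
  · obtain rfl : s = 1 := by omega
    exact hrun.init_mem

/-! ### The regret bound. -/

theorem sum_Ioc_le_of_telescope {a b : ℕ} (hab : a ≤ b) {L q c : ℕ → ℝ} {p r : ℝ}
    (h : ∀ s ∈ Finset.Ioc a b, L s ≤ p * (q s - q (s + 1)) + r * c s) :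
    ∑ s ∈ Finset.Ioc a b, L s ≤ p * (q (a + 1) - q (b + 1)) + r * ∑ s ∈ Finset.Ioc a b, c s := by
  induction b, hab using Nat.le_induction with
  | base => simp
  | succ b hab ih =>
    rw [Finset.sum_Ioc_succ_top hab, Finset.sum_Ioc_succ_top hab]
    have h1 := ih fun s hs => h s (by simp only [Finset.mem_Ioc] at hs ⊢; omega)
    have h2 := h (b + 1) (by simp only [Finset.mem_Ioc]; omega)
    linarith

theorem sum_loss_le {𝒦 : Set (Vec d)} {η : ℝ} {K T : ℕ} {t : ℕ → ℕ} {G₀ : Mat d}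
    {f : ℕ → Vec d → ℝ} {g x : ℕ → Vec d} {u : Vec d} {D : ℝ} (hK : Convex ℝ 𝒦)
    (hη : 0 < η) (hG : G₀.PosDef) (ht : IsUpdatePoints K T t)
    (hrun : IsRun 𝒦 η K T t G₀ f g x) (hu : u ∈ 𝒦)
    (hD : ∀ s ∈ Finset.Icc 1 T, ‖x s - u‖ ≤ D) :
    ∑ s ∈ Finset.Icc 1 T, (f s (x s) - f s u) ≤
      1 / (2 * η) * (D ^ 2 * (msqrt (covar G₀ g T)).trace) +
        η / 2 * ∑ k ∈ Finset.Ico 1 K, (minvSqrt (covar G₀ g (t k)) * incr G₀ g t k).trace := by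
  -- The last update produces $x_{T+1}$, which the diameter bound does not cover; zero replaces its
  -- offset and only lowers the subtracted potential.
  set y : ℕ → Vec d := fun s => if s ≤ T then x s - u else 0 with hy
  have hyT : ∀ s, s ≤ T → y s = x s - u := fun s hs => if_pos hs
  have hyD : ∀ s, 1 ≤ s → ‖y s‖ ^ 2 ≤ D ^ 2 := by
    intro s hs
    by_cases hsT : s ≤ T
    · rw [hyT s hsT]
      exact pow_le_pow_left₀ (norm_nonneg _) (hD s (Finset.mem_Icc.2 ⟨hs, hsT⟩)) 2
    · simp only [hy, if_neg hsT, norm_zero, ne_eq, OfNat.ofNat_ne_zero, not_false_eq_true, zero_pow]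
      exact sq_nonneg D
  set H : ℕ → Mat d := fun k => msqrt (covar G₀ g (t k)) with hH
  have hHp : ∀ k, (H k).PosDef := fun k => msqrt_posDef (covar_posDef hG g _)
  have hp : 0 < 1 / (2 * η) := by positivity
  have hstep : ∀ k, 1 ≤ k → k < K → ∀ s ∈ Finset.Ioc (t k) (t (k + 1)),
      f s (x s) - f s u ≤ 1 / (2 * η) * (sqNorm (H k) (y s) - sqNorm (H k) (y (s + 1))) +
        η / 2 * ((H k)⁻¹ * vecMulVec (g s).ofLp (g s).ofLp).trace := by
    intro k hk hkK s hs
    rw [Finset.mem_Ioc] at hs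
    have hsT : s ≤ T := hs.2.trans <| (ht.monotone (by omega) hkK le_rfl).trans_eq ht.last
    have hsm : s ∈ Finset.Icc 1 T := Finset.mem_Icc.2 ⟨by omega, hsT⟩
    have h := loss_sub_le hK hη (hHp k) (hrun.convex s hsm) (hrun.grad s hsm)
      (hrun.mem ht (by omega) hsT) hu (hrun.update k hk hkK s hs.1 hs.2)
    have h2 : sqNorm (H k) (y (s + 1)) ≤ sqNorm (H k) (x (s + 1) - u) := by
      by_cases hsT' : s + 1 ≤ T
      · rw [hyT _ hsT']
      · simp only [hy, if_neg hsT']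
        refine le_trans (le_of_eq ?_) (sqNorm_nonneg (hHp k).posSemidef _)
        simp [sqNorm]
    rw [hyT s hsT]
    have := mul_le_mul_of_nonneg_left h2 hp.le
    linarith
  -- The potential at the start of epoch $k$ is already measured in the new norm $H_k$; each change
  -- of norm costs at most $D^2\operatorname{tr}(H_{k+1}-H_k)$.
  have main : ∀ k, 1 ≤ k → k ≤ K →
      ∑ s ∈ Finset.Icc 1 (t k), (f s (x s) - f s u) +
        1 / (2 * η) * sqNorm (H k) (y (t k + 1)) ≤
      1 / (2 * η) * (D ^ 2 * (H k).trace) +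
        η / 2 * ∑ j ∈ Finset.Ico 1 k, ((H j)⁻¹ * incr G₀ g t j).trace := by
    intro k hk
    induction k, hk using Nat.le_induction with
    | base =>
      intro _
      have h1 := sqNorm_le_norm_sq_mul_trace (hHp 1).posSemidef (y (t 1 + 1))
      have h2 := mul_le_mul_of_nonneg_right (hyD (t 1 + 1) (by omega))
        (hHp 1).posSemidef.trace_nonneg
      have := mul_le_mul_of_nonneg_left (h1.trans h2) hp.le
      simpa [ht.first] using this
    | succ k hk ih =>
      intro hkK
      have htk := ht.mono k hk hkK
      have h0 := ih (by omega)
      have h1 := sum_Ioc_le_of_telescope htk (hstep k hk hkK)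
      have hsplit : ∑ s ∈ Finset.Icc 1 (t (k + 1)), (f s (x s) - f s u) =
          ∑ s ∈ Finset.Icc 1 (t k), (f s (x s) - f s u) +
            ∑ s ∈ Finset.Ioc (t k) (t (k + 1)), (f s (x s) - f s u) := by
        have e : ∀ n, Finset.Icc 1 n = Finset.Ioc 0 n := fun n => rfl
        rw [e, e, Finset.sum_Ioc_consecutive _ (Nat.zero_le _) htk]
      have hinc : ∑ s ∈ Finset.Ioc (t k) (t (k + 1)),
          ((H k)⁻¹ * vecMulVec (g s).ofLp (g s).ofLp).trace =
          ((H k)⁻¹ * incr G₀ g t k).trace := by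
        rw [incr, covar_sub htk, Finset.mul_sum, trace_sum]
      have hdiff := msqrt_covar_sub_posSemidef hG g htk
      have h2 := sqNorm_le_norm_sq_mul_trace hdiff (y (t (k + 1) + 1))
      have h3 := mul_le_mul_of_nonneg_right (hyD (t (k + 1) + 1) (by omega)) hdiff.trace_nonneg
      have h4 := h2.trans h3
      rw [sqNorm_sub_matrix, trace_sub] at h4
      have h5 := mul_le_mul_of_nonneg_left h4 hp.le
      rw [hinc] at h1
      rw [hsplit, Finset.sum_Ico_succ_top hk]
      simp only [hH] at *
      linarith
  have h := main K ht.one_le le_rfl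
  have h2 := mul_nonneg hp.le (sqNorm_nonneg (hHp K).posSemidef (y (t K + 1)))
  simp only [hH, ht.last] at h h2
  simp only [minvSqrt]
  linarith

theorem trace_minvSqrt_mul_incr_le {G₀ : Mat d} {t : ℕ → ℕ} {k : ℕ} (hG : G₀.PosDef)
    (g : ℕ → Vec d) (htk : t k ≤ t (k + 1)) :
    (minvSqrt (covar G₀ g (t k)) * incr G₀ g t k).trace ≤
      2 * (msqrt (covar G₀ g (t (k + 1)))).trace - 2 * (msqrt (covar G₀ g (t k))).trace +
        err G₀ g t k := by
  have hA : (incr G₀ g t k).PosSemidef := covar_sub_posSemidef htk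
  obtain ⟨hSh, hS⟩ := lyap_spec (covar_posDef hG g (t k)) hA.1
  refine trace_inv_mul_le_add_err (msqrt_posDef (covar_posDef hG g _))
    (msqrt_covar_sub_posSemidef hG g htk) ?_ hSh hS
  rw [msqrt_mul_self (covar_posDef hG g _).posSemidef,
    msqrt_mul_self (covar_posDef hG g _).posSemidef, incr]

theorem err_le {G₀ : Mat d} {t : ℕ → ℕ} {k : ℕ} (hG : G₀.PosDef)
    (g : ℕ → Vec d) (htk : t k ≤ t (k + 1))
    {β : ℝ} (hβ : 0 < β)
    (hA : (β • covar G₀ g (t k) - incr G₀ g t k).PosSemidef) :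
    err G₀ g t k ≤ β ^ 2 / 2 * (msqrt (covar G₀ g (t k))).trace ∧
    err G₀ g t k ≤ β * (√(1 + β) + 1) / 2 * ((msqrt (covar G₀ g (t (k + 1)))).trace -
      (msqrt (covar G₀ g (t k))).trace) := by
  have hAp : (incr G₀ g t k).PosSemidef := covar_sub_posSemidef htk
  have hc := fun j => covar_posDef hG g j
  obtain ⟨hSh, hS⟩ := lyap_spec (hc (t k)) hAp.1
  have hA' := hA
  rw [← msqrt_mul_self (hc (t k)).posSemidef] at hA'
  have h1 := trace_lyapunov_le (msqrt_posDef (hc _)) hSh hS hAp hA'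
  have h2 := trace_lyapunov_le_sub hβ (msqrt_posDef (hc _)) (msqrt_posDef (hc _))
    (msqrt_covar_sub_posSemidef hG g htk) (by
      rw [msqrt_mul_self (hc _).posSemidef, msqrt_mul_self (hc _).posSemidef, incr]) hS hA'
  have h3 : err G₀ g t k ≤ β * (lyap (covar G₀ g (t k)) (incr G₀ g t k)).trace := h1.1
  have h4 := mul_le_mul_of_nonneg_left h1.2 hβ.le
  have h5 := mul_le_mul_of_nonneg_left h2 hβ.le
  constructor <;> linarith

theorem regretTo_le {𝒦 : Set (Vec d)} {η : ℝ} {K T : ℕ} {t : ℕ → ℕ} {G₀ : Mat d}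
    {f : ℕ → Vec d → ℝ} {g x : ℕ → Vec d} {u : Vec d} {D : ℝ} (hK : Convex ℝ 𝒦)
    (hη : 0 < η) (hG : G₀.PosDef) (ht : IsUpdatePoints K T t)
    (hrun : IsRun 𝒦 η K T t G₀ f g x) (hu : u ∈ 𝒦)
    (hD : ∀ s ∈ Finset.Icc 1 T, ‖x s - u‖ ≤ D) :
    regretTo f x T u ≤ D ^ 2 / η * (msqrt (covar G₀ g T)).trace +
      η / 2 * (2 * (msqrt (covar G₀ g T)).trace - 2 * (msqrt G₀).trace
        + ∑ k ∈ Finset.Ico 1 K, err G₀ g t k) := by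
  have h := sum_loss_le hK hη hG ht hrun hu hD
  rw [Finset.sum_sub_distrib] at h
  have hsum : ∑ k ∈ Finset.Ico 1 K, (minvSqrt (covar G₀ g (t k)) * incr G₀ g t k).trace ≤
      2 * (msqrt (covar G₀ g T)).trace - 2 * (msqrt G₀).trace
        + ∑ k ∈ Finset.Ico 1 K, err G₀ g t k := by
    have h1 := Finset.sum_le_sum fun k (hk : k ∈ Finset.Ico 1 K) =>
      trace_minvSqrt_mul_incr_le hG g
        (ht.mono k (Finset.mem_Ico.1 hk).1 (Finset.mem_Ico.1 hk).2)
    refine h1.trans_eq ?_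
    have h2 := Finset.sum_Ico_sub (fun k => 2 * (msqrt (covar G₀ g (t k))).trace) ht.one_le
    have h0 : covar G₀ g 0 = G₀ := by simp [covar]
    rw [Finset.sum_add_distrib, h2, ht.last, ht.first, h0]
  have htr := mul_nonneg (sq_nonneg D)
    (msqrt_posSemidef (covar_posDef hG g T).posSemidef).trace_nonneg
  have h3 : 1 / (2 * η) * (D ^ 2 * (msqrt (covar G₀ g T)).trace) ≤
      D ^ 2 / η * (msqrt (covar G₀ g T)).trace := by
    rw [div_mul_eq_mul_div, one_mul, div_mul_eq_mul_div]
    exact div_le_div_of_nonneg_left htr hη (by linarith)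
  have h4 := mul_le_mul_of_nonneg_left hsum (show 0 ≤ η / 2 by positivity)
  rw [regretTo, cumLoss]
  linarith

theorem regret_eq_regretTo {𝒦 : Set (Vec d)} {f : ℕ → Vec d → ℝ} {x : ℕ → Vec d} {T : ℕ}
    {u : Vec d} (hu : u ∈ 𝒦) (hmin : IsMinOn (cumLoss f T) 𝒦 u) :
    regret 𝒦 f x T = regretTo f x T u := by
  rw [regret, regretTo, hmin.iInf_eq hu]

/-! ### The well-conditioned case. -/

theorem sum_err_le {K T : ℕ} {t : ℕ → ℕ} {G₀ : Mat d} {g : ℕ → Vec d} {β : ℝ} (hβ : 0 < β)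
    (hG : G₀.PosDef) (ht : IsUpdatePoints K T t)
    (hA : ∀ k ∈ Finset.Ico 1 K, (β • covar G₀ g (t k) - incr G₀ g t k).PosSemidef) :
    ∑ k ∈ Finset.Ico 1 K, err G₀ g t k ≤
      β * (√(1 + β) + 1) / 2 * (msqrt (covar G₀ g T)).trace := by
  have h1 := Finset.sum_le_sum fun k (hk : k ∈ Finset.Ico 1 K) =>
    (err_le hG g (ht.mono k (Finset.mem_Ico.1 hk).1 (Finset.mem_Ico.1 hk).2) hβ (hA k hk)).2
  refine h1.trans ?_
  rw [← Finset.mul_sum,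
    Finset.sum_Ico_sub (fun k => (msqrt (covar G₀ g (t k))).trace) ht.one_le, ht.last]
  have := (msqrt_posSemidef (covar_posDef hG g (t 1)).posSemidef).trace_nonneg
  exact mul_le_mul_of_nonneg_left (by linarith) (by positivity)

/-- Any eigenvalue of $G$ forces $\sigma_{\min}\le\sigma_{\max}$; in dimension $0$ there is none,
but the traces vanish. -/
theorem trace_le_sqrt_mul_trace {G P : Mat d} (hG : G.IsHermitian) {a σmin σmax : ℝ} (ha : 0 < a)
    (hσ : 0 < σmin) (hspec : spectrum ℝ G ⊆ Icc (σmin * a) (σmax * a)) (hP : P.PosSemidef) :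
    P.trace ≤ √(σmax / σmin) * P.trace := by
  rcases isEmpty_or_nonempty (Fin d) with h | ⟨⟨i⟩⟩
  · simp [trace]
  · have hi := hspec (hG.eigenvalues_mem_spectrum_real i)
    have h1 : σmin ≤ σmax := le_of_mul_le_mul_right (hi.1.trans hi.2) ha
    have h2 : 1 ≤ √(σmax / σmin) := Real.one_le_sqrt.2 ((one_le_div hσ).2 h1)
    exact le_mul_of_one_le_left hP.trace_nonneg h2

theorem withProb_of_forall {Ω : Type*} [MeasurableSpace Ω] {P : Measure Ω} {K : ℕ} {δ : ℝ}
    (hK : 1 ≤ K) (hδ : 0 < δ) {E : ℕ → Ω → Prop} {F B : Ω → Prop}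
    (hE : ∀ k ∈ Finset.Ico 1 K, WithProb P (δ / (2 * K)) (E k))
    (hF : WithProb P (δ / (2 * K)) F) (h : ∀ ω, (∀ k ∈ Finset.Ico 1 K, E k ω) → F ω → B ω) :
    WithProb P δ B := by
  have hsub : {ω | ¬ B ω} ⊆ (⋃ k ∈ Finset.Ico 1 K, {ω | ¬ E k ω}) ∪ {ω | ¬ F ω} := by
    intro ω hω
    by_contra hcon
    rw [mem_union, not_or] at hcon
    refine hω (h ω (fun k hk => ?_) (not_not.1 hcon.2))
    by_contra hk'
    exact hcon.1 (mem_biUnion hk hk')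
  have hK0 : (0 : ℝ) < K := by exact_mod_cast hK
  have hpos : 0 ≤ δ / (2 * K) := by positivity
  calc P {ω | ¬ B ω} ≤ P (⋃ k ∈ Finset.Ico 1 K, {ω | ¬ E k ω}) + P {ω | ¬ F ω} :=
        (measure_mono hsub).trans (measure_union_le _ _)
    _ ≤ ∑ k ∈ Finset.Ico 1 K, ENNReal.ofReal (δ / (2 * K)) + ENNReal.ofReal (δ / (2 * K)) :=
        add_le_add ((measure_biUnion_finset_le _ _).trans (Finset.sum_le_sum hE)) hF
    _ = ENNReal.ofReal ((K - 1 : ℕ) * (δ / (2 * K)) + δ / (2 * K)) := by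
        rw [Finset.sum_const, Nat.card_Ico, ENNReal.ofReal_add (by positivity) hpos,
          ENNReal.ofReal_mul (by positivity), ENNReal.ofReal_natCast, nsmul_eq_mul]
    _ ≤ ENNReal.ofReal δ := by
        refine ENNReal.ofReal_le_ofReal ?_
        rw [Nat.cast_sub hK, Nat.cast_one]
        -- The union bound runs over $K$ events: $K-1$ epochs and a single spectral event.
        have : ((K : ℝ) - 1) * (δ / (2 * K)) + δ / (2 * K) = δ / 2 := by field_simp; ring
        rw [this]
        linarith

end EpochAdaGrad

theorem mainTheorem4 :
    -- the regret bound of step-skipping AdaGrad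
    (∀ (d : ℕ) (𝒦 : Set (EpochAdaGrad.Vec d)) (η : ℝ) (K T : ℕ) (t : ℕ → ℕ)
      (G₀ : EpochAdaGrad.Mat d) (f : ℕ → EpochAdaGrad.Vec d → ℝ)
      (g x : ℕ → EpochAdaGrad.Vec d) (u : EpochAdaGrad.Vec d) (D : ℝ),
      Convex ℝ 𝒦 → IsClosed 𝒦 → 0 < η → G₀.PosDef →
      EpochAdaGrad.IsUpdatePoints K T t → EpochAdaGrad.IsRun 𝒦 η K T t G₀ f g x →
      u ∈ 𝒦 → (∀ s ∈ Finset.Icc 1 T, ‖x s - u‖ ≤ D) →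
      (∀ k ∈ Finset.Ico 1 K, ∀ i j, MeasureTheory.IntegrableOn
        (fun τ => EpochAdaGrad.lyapIntegrand (EpochAdaGrad.covar G₀ g (t k))
          (EpochAdaGrad.incr G₀ g t k) τ i j) (Set.Ioi 0)) ∧
      EpochAdaGrad.regretTo f x T u ≤
        D ^ 2 / η * (EpochAdaGrad.msqrt (EpochAdaGrad.covar G₀ g T)).trace +
        η / 2 * (2 * (EpochAdaGrad.msqrt (EpochAdaGrad.covar G₀ g T)).trace
          - 2 * (EpochAdaGrad.msqrt G₀).trace
          + ∑ k ∈ Finset.Ico 1 K, EpochAdaGrad.err G₀ g t k) ∧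
      (IsMinOn (EpochAdaGrad.cumLoss f T) 𝒦 u →
        EpochAdaGrad.regret 𝒦 f x T ≤
          D ^ 2 / η * (EpochAdaGrad.msqrt (EpochAdaGrad.covar G₀ g T)).trace +
          η / 2 * (2 * (EpochAdaGrad.msqrt (EpochAdaGrad.covar G₀ g T)).trace
            - 2 * (EpochAdaGrad.msqrt G₀).trace
            + ∑ k ∈ Finset.Ico 1 K, EpochAdaGrad.err G₀ g t k))) ∧
    -- the extra factor `log T` in the well-conditioned case
    (∀ β : ℝ, 0 < β → ∃ C : ℝ, 0 < C ∧
      ∀ (d : ℕ) (𝒦 : Set (EpochAdaGrad.Vec d)) (η : ℝ) (K T : ℕ) (t : ℕ → ℕ)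
        (G₀ : EpochAdaGrad.Mat d)
        (Ω : Type*) (_ : MeasurableSpace Ω) (P : MeasureTheory.Measure Ω)
        (_ : MeasureTheory.IsProbabilityMeasure P)
        (f : Ω → ℕ → EpochAdaGrad.Vec d → ℝ) (g x : Ω → ℕ → EpochAdaGrad.Vec d)
        (u : Ω → EpochAdaGrad.Vec d) (D : Ω → ℝ) (δ σmin σmax : ℝ),
        Convex ℝ 𝒦 → IsClosed 𝒦 → 0 < η → G₀.PosDef → 2 ≤ T → 0 < δ → 0 < σmin →
        EpochAdaGrad.IsUpdatePoints K T t →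
        (∀ ω, EpochAdaGrad.IsRun 𝒦 η K T t G₀ (f ω) (g ω) (x ω)) →
        (∀ ω, u ω ∈ 𝒦) → (∀ ω, ∀ s ∈ Finset.Icc 1 T, ‖x ω s - u ω‖ ≤ D ω) →
        (∀ k ∈ Finset.Ico 1 K, EpochAdaGrad.WithProb P (δ / (2 * K)) fun ω =>
          (β • EpochAdaGrad.covar G₀ (g ω) (t k)
            - EpochAdaGrad.incr G₀ (g ω) t k).PosSemidef) →
        (∀ k ∈ Finset.Icc 1 K, 0 < t k → EpochAdaGrad.WithProb P (δ / (2 * K)) fun ω =>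
          spectrum ℝ (EpochAdaGrad.covar G₀ (g ω) (t k)) ⊆
            Set.Icc (σmin * t k) (σmax * t k)) →
        EpochAdaGrad.WithProb P δ fun ω =>
          (∀ k ∈ Finset.Ico 1 K, EpochAdaGrad.err G₀ (g ω) t k ≤
            β ^ 2 * √(σmax / σmin) *
              (EpochAdaGrad.msqrt (EpochAdaGrad.covar G₀ (g ω) (t k))).trace) ∧
          ∑ k ∈ Finset.Ico 1 K, EpochAdaGrad.err G₀ (g ω) t k ≤
            C * √(σmax / σmin) * Real.log T *
              (EpochAdaGrad.msqrt (EpochAdaGrad.covar G₀ (g ω) T)).trace ∧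
          EpochAdaGrad.regretTo (f ω) (x ω) T (u ω) ≤
            D ω ^ 2 / η * (EpochAdaGrad.msqrt (EpochAdaGrad.covar G₀ (g ω) T)).trace +
            C * η * √(σmax / σmin) * Real.log T *
              (EpochAdaGrad.msqrt (EpochAdaGrad.covar G₀ (g ω) T)).trace ∧
          (IsMinOn (EpochAdaGrad.cumLoss (f ω) T) 𝒦 (u ω) →
            EpochAdaGrad.regret 𝒦 (f ω) (x ω) T ≤
              D ω ^ 2 / η * (EpochAdaGrad.msqrt (EpochAdaGrad.covar G₀ (g ω) T)).trace +
              C * η * √(σmax / σmin) * Real.log T *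
                (EpochAdaGrad.msqrt (EpochAdaGrad.covar G₀ (g ω) T)).trace)) := by
  refine ⟨?_, ?_⟩
  · intro d 𝒦 η K T t G₀ f g x u D hK _ hη hG ht hrun hu hD
    have h := EpochAdaGrad.regretTo_le hK hη hG ht hrun hu hD
    refine ⟨fun k _ i j => EpochAdaGrad.integrableOn_lyapIntegrand
      (EpochAdaGrad.covar_posDef hG g (t k)) _ i j, h, fun hmin => ?_⟩
    rwa [EpochAdaGrad.regret_eq_regretTo hu hmin]
  · intro β hβ
    have hlog2 : 0 < Real.log 2 := Real.log_pos one_lt_two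
    set c := β * (√(1 + β) + 1) / 2 with hc
    have hc0 : 0 < c := by positivity
    -- Here $c$ bounds $\sum_k\epsilon_k/\operatorname{tr}G_T^{1/2}$, the $1$ pays for the main term
    -- of the regret, and $\log 2$ is the least value of $\log T$.
    refine ⟨(1 + c) / Real.log 2, by positivity, ?_⟩
    intro d 𝒦 η K T t G₀ Ω _ P _ f g x u D δ σmin σmax hK _ hη hG hT hδ hσ ht hrun hu hD hE hF
    have htK : 0 < t K := by rw [ht.last]; omega
    -- The spectral event at $t_K=T$ alone already gives $\sigma_{\max}/\sigma_{\min}\ge1$ when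
    -- $d>0$.
    refine EpochAdaGrad.withProb_of_forall ht.one_le hδ hE
      (hF K (Finset.mem_Icc.2 ⟨ht.one_le, le_rfl⟩) htK) fun ω hA hspec => ?_
    have hκ := fun j => EpochAdaGrad.trace_le_sqrt_mul_trace
      (EpochAdaGrad.covar_posDef hG (g ω) (t K)).1 (by exact_mod_cast htK) hσ hspec
      (EpochAdaGrad.msqrt_posSemidef (EpochAdaGrad.covar_posDef hG (g ω) j).posSemidef)
    have htr := fun j => (EpochAdaGrad.msqrt_posSemidef
      (EpochAdaGrad.covar_posDef hG (g ω) j).posSemidef).trace_nonneg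
    have hsum := EpochAdaGrad.sum_err_le hβ hG ht hA
    rw [← hc] at hsum
    have hreg := EpochAdaGrad.regretTo_le hK hη hG ht (hrun ω) (hu ω) (hD ω)
    have hG0 := (EpochAdaGrad.msqrt_posSemidef hG.posSemidef).trace_nonneg
    set τ := (EpochAdaGrad.msqrt (EpochAdaGrad.covar G₀ (g ω) T)).trace
    have hκT : τ ≤ √(σmax / σmin) * τ := hκ T
    have hτ : 0 ≤ τ := htr T
    have hlogT : Real.log 2 ≤ Real.log T :=
      Real.log_le_log two_pos (by exact_mod_cast hT)
    have hC : (1 + c) * τ ≤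
        (1 + c) / Real.log 2 * √(σmax / σmin) * Real.log T * τ := by
      have h1 : 1 ≤ Real.log T / Real.log 2 := (one_le_div hlog2).2 hlogT
      have h2 : (1 + c) * τ ≤ (1 + c) * (√(σmax / σmin) * τ) :=
        mul_le_mul_of_nonneg_left hκT (by positivity)
      calc (1 + c) * τ ≤ (1 + c) * (√(σmax / σmin) * τ) := h2
        _ ≤ (1 + c) * (√(σmax / σmin) * τ) * (Real.log T / Real.log 2) :=
          le_mul_of_one_le_right (by positivity) h1
        _ = _ := by ring
    have hregC : EpochAdaGrad.regretTo (f ω) (x ω) T (u ω) ≤ D ω ^ 2 / η * τ +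
        (1 + c) / Real.log 2 * η * √(σmax / σmin) * Real.log T * τ := by
      refine hreg.trans (add_le_add_right ?_ _)
      have h1 : η / 2 * (2 * τ - 2 * (EpochAdaGrad.msqrt G₀).trace +
          ∑ k ∈ Finset.Ico 1 K, EpochAdaGrad.err G₀ (g ω) t k) ≤ η * ((1 + c) * τ) := by
        have hcτ : 0 ≤ c * τ := by positivity
        have : 2 * τ - 2 * (EpochAdaGrad.msqrt G₀).trace +
          ∑ k ∈ Finset.Ico 1 K, EpochAdaGrad.err G₀ (g ω) t k ≤ 2 * ((1 + c) * τ) := by linarith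
        have := mul_le_mul_of_nonneg_left this (show 0 ≤ η / 2 by positivity)
        linarith
      refine h1.trans ((mul_le_mul_of_nonneg_left hC hη.le).trans_eq ?_)
      ring
    refine ⟨fun k hk => ?_, ?_, hregC, fun hmin => ?_⟩
    · have hk' := Finset.mem_Ico.1 hk
      have h1 := (EpochAdaGrad.err_le hG (g ω) (ht.mono k hk'.1 hk'.2) hβ (hA k hk)).1
      have h2 := mul_le_mul_of_nonneg_left (hκ (t k)) (sq_nonneg β)
      have h3 := mul_nonneg (sq_nonneg β) (htr (t k))
      linarith
    · linarith
    · rwa [EpochAdaGrad.regret_eq_regretTo (hu ω) hmin]
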